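/- Let $(W,S)$ be a Coxeter system with length function $\ell$, and for $s,t\in S$ let $m_{st}\in\{1,2,\dots\}\cup\{\infty\}$ be the order of $st$. Let $V$ be a real vector space with a symmetric bilinear form $B$ and vectors $\Delta=\{\alpha_s\mid s\in S\}\subset V$ such that (1) $\Delta$ is positively linearly independent, i.e. a finite sum $\sum_s a_s\alpha_s$ with all $a_s\ge 0$ vanishes only if all $a_s=0$; (2) $B(\alpha_s,\alpha_t)=-\cos(\pi/m_{st})$ if $m_{st}<\infty$ and $B(\alpha_s,\alpha_t)\le -1$ if $m_{st}=\infty$; (3) $B(\alpha_s,\alpha_s)=1$ for all $s\in S$. Let $W$ act on $V$ by $s(v)=v-2B(\alpha_s,v)\alpha_s$ for $s\in S$. Put $\Phi=W(\Delta)$, $\Phi^+=\Phi\cap\operatorname{cone}(\Delta)$, $\Phi^-=-\Phi^+$, and, for $w\in W$, $\Phi(w)=\{\alpha\in\Phi^+\mid w^{-1}(\alpha)\in\Phi^-\}$. Let $T=\bigcup_{w\in W}wSw^{-1}$ be the set of reflections; for $t\in T$ let $\alpha_t\in\Phi^+$ be the positive root such that $t(v)=v-2B(\alpha_t,v)\alpha_t$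 for all $v\in V$. For $t\in T$, an element $p\in W$, $p\ne e$, is called a $t$-prefix if for every reduced word $p=s_1\cdots s_ks_{k+1}$ the palindrome $s_1\cdots s_ks_{k+1}s_k\cdots s_1$ is a reduced word for $t$. Let $w\in W$ and let $r\in S$ be a right descent of $w$, i.e. $\ell(wr)<\ell(w)$. Then $-w(\alpha_r)\in\Phi(w)$. Moreover, if $t\in T$ is such that $\alpha_t=-w(\alpha_r)$, then $w$ is a $t$-prefix if and only if $B(\alpha,\alpha_t)>0$ for every $\alpha\in\Phi(w)$. -/

import Mathlib

/-- A geometric representation datum for the Coxeter matrix `M` (`M s t = 0` encodes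
`m_{st} = ∞`): a real vector space `V` with a symmetric bilinear form `B` and simple roots `α_s`.
The action of the Coxeter group on `V` is constructed from it below. -/
structure GeometricRepresentation {S : Type*} (M : CoxeterMatrix S)
    (V : Type*) [AddCommGroup V] [Module ℝ V] where
  form : LinearMap.BilinForm ℝ V
  form_symm : ∀ u v : V, form u v = form v u
  simpleRoot : S → V
  /-- The simple roots are positively linearly independent. -/
  pos_linearIndependent : ∀ c : S →₀ ℝ, (∀ s, 0 ≤ c s) →
    Finsupp.linearCombination ℝ simpleRoot c = 0 → c = 0
  form_self : ∀ s, form (simpleRoot s) (simpleRoot s) = 1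
  form_of_finite : ∀ s t, M s t ≠ 0 →
    form (simpleRoot s) (simpleRoot t) = -Real.cos (Real.pi / (M s t : ℝ))
  form_of_infinite : ∀ s t, M s t = 0 → form (simpleRoot s) (simpleRoot t) ≤ -1

namespace GeometricRepresentation

variable {S V W : Type*} [AddCommGroup V] [Module ℝ V] [Group W] {M : CoxeterMatrix S}
  (G : GeometricRepresentation M V) (cs : CoxeterSystem M W)

theorem two_form_self (s : S) :
    ((2 : ℝ) • G.form (G.simpleRoot s)) (G.simpleRoot s) = 2 := by
  simp [G.form_self]

/-- The reflection `v ↦ v - 2 B(α_s, v) α_s` of `V`. -/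
noncomputable def simpleReflection (s : S) : V ≃ₗ[ℝ] V :=
  Module.reflection (G.two_form_self s)

theorem simpleReflection_apply (s : S) (v : V) :
    G.simpleReflection s v =
      v - (2 * G.form (G.simpleRoot s) v) • G.simpleRoot s := by
  simp [simpleReflection, Module.reflection_apply]

/-- The reflections in the simple roots satisfy the Coxeter relations. -/
theorem isLiftable_simpleReflection : M.IsLiftable G.simpleReflection := by
  intro s t
  rcases eq_or_ne (M s t) 0 with h0 | h0
  · rw [h0, pow_zero]
  rcases eq_or_ne s t with rfl | hst
  · rw [M.diagonal, pow_one]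
    ext v
    exact Module.involutive_reflection (G.two_form_self s) v
  have h1 : M s t ≠ 1 := fun h => hst (by_contra fun hne => M.off_diagonal s t hne h)
  have hB := G.form_of_finite s t h0
  have hB' : G.form (G.simpleRoot t) (G.simpleRoot s) = -Real.cos (Real.pi / (M s t : ℝ)) := by
    rw [G.form_symm, hB]
  generalize M s t = m at *
  have hm0 : (m : ℝ) ≠ 0 := by exact_mod_cast h0
  ext v
  have key := Module.reflection_mul_reflection_pow_apply (G.two_form_self s) (G.two_form_self t) m v
    (2 * Real.cos (2 * Real.pi / m)) (by
      simp only [LinearMap.smul_apply, smul_eq_mul, hB, hB']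
      rw [mul_div_assoc, Real.cos_two_mul]
      ring)
  change ((Module.reflection (G.two_form_self s) * Module.reflection (G.two_form_self t)) ^ m) v = v
  rw [key]
  rcases eq_or_ne m 2 with rfl | h2
  · norm_num [hB, hB']
    module
  have hm3 : 3 ≤ m := by omega
  have hsin : Real.sin (2 * Real.pi / m) ≠ 0 := by
    apply ne_of_gt
    apply Real.sin_pos_of_pos_of_lt_pi
    · positivity
    · have : (3 : ℝ) ≤ m := by exact_mod_cast hm3
      rw [div_lt_iff₀ (by positivity)]
      nlinarith [Real.pi_pos]
  have hS := fun n : ℤ => Polynomial.Chebyshev.S_two_mul_real_cos (2 * Real.pi / m) n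
  rcases Nat.even_or_odd' m with ⟨k, hk | hk⟩
  · have e1 : ((m : ℤ) - 2) / 2 = k - 1 := by omega
    have e2 : ((m : ℤ) - 1) / 2 = k - 1 := by omega
    have z : (Polynomial.Chebyshev.S ℝ ((k : ℤ) - 1)).eval (2 * Real.cos (2 * Real.pi / m)) = 0 := by
      apply (mul_eq_zero.mp _).resolve_right hsin
      rw [hS]
      have : (((k : ℤ) - 1 : ℤ) + 1 : ℝ) * (2 * Real.pi / m) = Real.pi := by
        have : (m : ℝ) = 2 * k := by exact_mod_cast hk
        rw [this] at hm0 ⊢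
        push_cast
        have hk0 : (k : ℝ) ≠ 0 := by intro h; apply hm0; rw [h, mul_zero]
        field_simp
        ring
      rw [this, Real.sin_pi]
    rw [e1, e2, z]
    simp
  · have e1 : ((m : ℤ) - 2) / 2 = k - 1 := by omega
    have e2 : ((m : ℤ) - 1) / 2 = k := by omega
    have e3 : ((m : ℤ) - 3) / 2 = k - 1 := by omega
    have e4 : (m : ℤ) / 2 = k := by omega
    have z : (Polynomial.Chebyshev.S ℝ (k : ℤ)).eval (2 * Real.cos (2 * Real.pi / m)) +
        (Polynomial.Chebyshev.S ℝ ((k : ℤ) - 1)).eval (2 * Real.cos (2 * Real.pi / m)) = 0 := by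
      apply (mul_eq_zero.mp _).resolve_right hsin
      rw [add_mul, hS, hS]
      have : (((k : ℤ) : ℝ) + 1) * (2 * Real.pi / m) =
          2 * Real.pi - (((k : ℤ) - 1 : ℤ) + 1 : ℝ) * (2 * Real.pi / m) := by
        have : (m : ℝ) = 2 * k + 1 := by exact_mod_cast hk
        rw [this] at hm0 ⊢
        push_cast
        field_simp
        ring
      rw [this, Real.sin_two_pi_sub]
      ring
    rw [e1, e2, e3, e4, z]
    simp

/-- The action of `W` on `V`, in which `s` acts as the reflection in `α_s`. -/
noncomputable def rep : W →* (V ≃ₗ[ℝ] V) :=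
  cs.lift ⟨G.simpleReflection, G.isLiftable_simpleReflection⟩

theorem rep_simple (s : S) (v : V) :
    G.rep cs (cs.simple s) v = v - (2 * G.form (G.simpleRoot s) v) • G.simpleRoot s := by
  rw [rep, cs.lift_apply_simple, simpleReflection_apply]

/-- The root system `Φ = W(Δ)`. -/
def roots : Set V := {v | ∃ (w : W) (s : S), v = G.rep cs w (G.simpleRoot s)}

/-- `cone(Δ)`: the nonnegative linear combinations of simple roots. -/
def cone : Set V :=
  {v | ∃ c : S →₀ ℝ, (∀ s, 0 ≤ c s) ∧ v = Finsupp.linearCombination ℝ G.simpleRoot c}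

/-- The positive roots `Φ⁺ = cone(Δ) ∩ Φ`. -/
def posRoots : Set V := G.cone ∩ G.roots cs

/-- The negative roots `Φ⁻ = -Φ⁺`. -/
def negRoots : Set V := {v | -v ∈ G.posRoots cs}

/-- The inversion set `Φ(w) = {α ∈ Φ⁺ ∣ w⁻¹(α) ∈ Φ⁻}`. -/
def inversionSet (w : W) : Set V :=
  {v | v ∈ G.posRoots cs ∧ G.rep cs w⁻¹ v ∈ G.negRoots cs}

/-- `v` is the positive root `α_t` of the reflection `t`, i.e. `v ∈ Φ⁺` and `t = s_v`:
`t` acts on `V` as the reflection in `v`. -/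
def IsRootOf (t : W) (v : V) : Prop :=
  v ∈ G.posRoots cs ∧ ∀ u : V, G.rep cs t u = u - (2 * G.form v u) • v

end GeometricRepresentation

/-- `p` is a `t`-prefix: `p ≠ 1` and, for every reduced word `s₁ ⋯ s_k s_{k+1}` of `p`, the
palindrome `s₁ ⋯ s_k s_{k+1} s_k ⋯ s₁` is a reduced word for the reflection `t`. -/
def CoxeterSystem.IsReflectionPrefix {S W : Type*} [Group W] {M : CoxeterMatrix S}
    (cs : CoxeterSystem M W) (t p : W) : Prop :=
  cs.IsReflection t ∧ p ≠ 1 ∧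
    ∀ (ω : List S) (s : S), cs.IsReduced (ω ++ [s]) → cs.wordProd (ω ++ [s]) = p →
      cs.IsReduced (ω ++ [s] ++ ω.reverse) ∧ cs.wordProd (ω ++ [s] ++ ω.reverse) = t

/-! Put v = wr. Then v(α_r) = α_t, so t = v r v⁻¹ = w v⁻¹, and positivity of all B(α, α_t) with α ∈
Φ(w) is equivalent to ℓ(t) = ℓ(w) + ℓ(v). Lengths add in w·v⁻¹ exactly when every inversion of w is
an inversion of t (`neg_rep_inv_mul_mem_cone`, `length_mul_of_neg_rep_inv_mem_cone`). Now t(α) = α −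
2B(α_t, α)α_t stays positive if B(α, α_t) ≤ 0. Conversely, if α ∈ Φ(w), α ≠ α_t and t(α) is
positive, then t(α) ∈ Φ(w) because w⁻¹t = r w⁻¹, and B(t(α), α_t) = −B(α, α_t), so one of the two
pairings is not positive.

Length additivity says that the palindrome of a reduced word ending in r is reduced; positivity also
excludes any other last letter.

All this rests on `rep_simpleRoot_mem_cone`, linking descents to signs of roots, which is proved by
reduction to rank two. -/

namespace CoxeterSystem

variable {S W : Type*} [Group W] {M : CoxeterMatrix S} (cs : CoxeterSystem M W)

/-! ### Words in two generators -/

/-- A length-additive factorization of `u` with right factor alternating in `s` and `t` extends to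
one whose left factor has neither `s` nor `t` as a right descent. -/
theorem exists_eq_mul_alternatingWord {u : W} {s t : S} {k : ℕ} {v : W}
    (hu : u = v * cs.wordProd (alternatingWord t s (k + 1)))
    (hl : cs.length v + (k + 1) = cs.length u) :
    ∃ (j : ℕ) (v' : W), k ≤ j ∧
      u = v' * cs.wordProd (alternatingWord t s (j + 1)) ∧
      cs.length v' + (j + 1) = cs.length u ∧
      ¬ cs.IsRightDescent v' s ∧ ¬ cs.IsRightDescent v' t := by
  induction hn : cs.length v generalizing v k with
  | zero =>
    obtain rfl := cs.length_eq_zero_iff.mp hn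
    exact ⟨k, 1, le_rfl, hu, hl, cs.not_isRightDescent_one s, cs.not_isRightDescent_one t⟩
  | succ n ih =>
    -- Otherwise the first letter of the alternating word would cancel into `v`, making `u` too
    -- short. Only the other letter can be a descent of `v`, and it prolongs the alternating word.
    have hx : ¬ cs.IsRightDescent v (if Even k then s else t) := by
      intro h
      rw [alternatingWord_succ', cs.wordProd_cons, ← mul_assoc] at hu
      have h1 := cs.length_mul_le (v * cs.simple (if Even k then s else t))
        (cs.wordProd (alternatingWord t s k))
      have h2 := cs.length_wordProd_le (alternatingWord t s k)
      rw [length_alternatingWord] at h2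
      rw [← hu] at h1
      unfold IsRightDescent at h
      omega
    by_cases hy : cs.IsRightDescent v (if Even (k + 1) then s else t)
    · have hl' := cs.isRightDescent_iff.mp hy
      obtain ⟨j, v', hj, h⟩ := ih (k := k + 1)
        (v := v * cs.simple (if Even (k + 1) then s else t))
        (by rw [alternatingWord_succ', cs.wordProd_cons, mul_assoc,
              cs.simple_mul_simple_cancel_left, hu])
        (by omega) (by omega)
      exact ⟨j, v', by omega, h⟩
    · refine ⟨k, v, le_rfl, hu, by omega, ?_⟩
      by_cases hk : Even k
      · have hk' : ¬ Even (k + 1) := by simpa [Nat.even_add_one] using hk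
        rw [if_pos hk] at hx
        rw [if_neg hk'] at hy
        exact ⟨hx, hy⟩
      · have hk' : Even (k + 1) := by simpa [Nat.even_add_one] using hk
        rw [if_neg hk] at hx
        rw [if_pos hk'] at hy
        exact ⟨hy, hx⟩

end CoxeterSystem

theorem Polynomial.Chebyshev.one_le_eval_U_of_one_le {c : ℝ} (hc : 1 ≤ c) (n : ℕ) :
    1 ≤ (Polynomial.Chebyshev.U ℝ (n : ℤ)).eval c := by
  -- Monotonicity in `n` is carried along because the three-term recurrence subtracts the earlier
  -- term.
  suffices h : 1 ≤ (Polynomial.Chebyshev.U ℝ (n : ℤ)).eval c ∧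
      (Polynomial.Chebyshev.U ℝ (n : ℤ)).eval c ≤
        (Polynomial.Chebyshev.U ℝ ((n : ℤ) + 1)).eval c from h.1
  induction n with
  | zero =>
    simp
    linarith
  | succ n ih =>
    have h := congrArg (Polynomial.eval c) (Polynomial.Chebyshev.U_add_two ℝ (n : ℤ))
    simp only [Polynomial.eval_sub, Polynomial.eval_mul, Polynomial.eval_ofNat,
      Polynomial.eval_X] at h
    obtain ⟨h1, h2⟩ := ih
    push_cast
    rw [add_assoc, one_add_one_eq_two, h]
    exact ⟨h1.trans h2, by nlinarith⟩

namespace GeometricRepresentation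

variable {S V W : Type*} [AddCommGroup V] [Module ℝ V] [Group W] {M : CoxeterMatrix S}
  (G : GeometricRepresentation M V) (cs : CoxeterSystem M W)

/-! ### The action, the form and the cone -/

theorem rep_mul_apply (x y : W) (v : V) : G.rep cs (x * y) v = G.rep cs x (G.rep cs y v) := by
  rw [map_mul]
  rfl

theorem rep_one_apply (v : V) : G.rep cs 1 v = v := by
  rw [map_one]
  rfl

theorem rep_inv_rep (x : W) (v : V) : G.rep cs x⁻¹ (G.rep cs x v) = v := by
  rw [← rep_mul_apply, inv_mul_cancel, rep_one_apply]

theorem rep_rep_inv (x : W) (v : V) : G.rep cs x (G.rep cs x⁻¹ v) = v := by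
  rw [← rep_mul_apply, mul_inv_cancel, rep_one_apply]

theorem rep_simple_self (s : S) :
    G.rep cs (cs.simple s) (G.simpleRoot s) = -G.simpleRoot s := by
  rw [rep_simple, form_self]
  module

theorem rep_mul_simple_self (x : W) (s : S) :
    G.rep cs (x * cs.simple s) (G.simpleRoot s) = -G.rep cs x (G.simpleRoot s) := by
  rw [rep_mul_apply, rep_simple_self, map_neg]

theorem form_rep_rep (x : W) (u v : V) : G.form (G.rep cs x u) (G.rep cs x v) = G.form u v := by
  induction x using cs.simple_induction_left with
  | one => simp only [rep_one_apply]
  | mul_simple_left x s ih =>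
    rw [rep_mul_apply, rep_mul_apply, ← ih, rep_simple, rep_simple]
    simp only [map_sub, map_smul, LinearMap.sub_apply, LinearMap.smul_apply, smul_eq_mul,
      form_self]
    rw [G.form_symm (G.rep cs x u) (G.simpleRoot s)]
    ring

theorem form_simpleRoot_nonpos {s t : S} (h : s ≠ t) :
    G.form (G.simpleRoot s) (G.simpleRoot t) ≤ 0 := by
  by_cases h0 : M s t = 0
  · linarith [G.form_of_infinite s t h0]
  · rw [G.form_of_finite s t h0, Left.neg_nonpos_iff]
    have h2 : (2 : ℝ) ≤ M s t := by
      have := M.off_diagonal s t h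
      exact_mod_cast (by omega : 2 ≤ M s t)
    apply Real.cos_nonneg_of_neg_pi_div_two_le_of_le
    · have : 0 ≤ Real.pi / M s t := by positivity
      linarith [Real.pi_pos]
    · exact div_le_div_of_nonneg_left Real.pi_pos.le (by norm_num) h2

theorem add_mem_cone {u v : V} (hu : u ∈ G.cone) (hv : v ∈ G.cone) : u + v ∈ G.cone := by
  obtain ⟨c, hc, rfl⟩ := hu
  obtain ⟨d, hd, rfl⟩ := hv
  exact ⟨c + d, fun s => add_nonneg (hc s) (hd s), by rw [map_add]⟩

theorem smul_mem_cone {a : ℝ} (ha : 0 ≤ a) {v : V} (hv : v ∈ G.cone) : a • v ∈ G.cone := by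
  obtain ⟨c, hc, rfl⟩ := hv
  exact ⟨a • c, fun s => mul_nonneg ha (hc s), by rw [map_smul]⟩

theorem simpleRoot_mem_cone (s : S) : G.simpleRoot s ∈ G.cone := by
  classical
  refine ⟨Finsupp.single s 1, fun t => ?_, by simp⟩
  rw [Finsupp.single_apply]
  split_ifs <;> norm_num

theorem eq_zero_of_mem_cone_of_neg_mem_cone {v : V} (h : v ∈ G.cone) (h' : -v ∈ G.cone) :
    v = 0 := by
  obtain ⟨c, hc, hcv⟩ := h
  obtain ⟨d, hd, hdv⟩ := h'
  have h0 := G.pos_linearIndependent (c + d) (fun s => add_nonneg (hc s) (hd s))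
    (by rw [map_add, ← hcv, ← hdv, add_neg_cancel])
  have : c = 0 := by
    ext s
    have h1 := DFunLike.congr_fun h0 s
    have h2 := hc s
    have h3 := hd s
    simp only [Finsupp.coe_add, Pi.add_apply, Finsupp.coe_zero, Pi.zero_apply] at h1 ⊢
    linarith
  rw [hcv, this, map_zero]

theorem form_self_of_mem_roots {v : V} (hv : v ∈ G.roots cs) : G.form v v = 1 := by
  obtain ⟨w, s, rfl⟩ := hv
  rw [form_rep_rep, form_self]

theorem ne_zero_of_mem_roots {v : V} (hv : v ∈ G.roots cs) : v ≠ 0 := by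
  rintro rfl
  simpa using G.form_self_of_mem_roots cs hv

theorem rep_mem_roots (x : W) {v : V} (hv : v ∈ G.roots cs) : G.rep cs x v ∈ G.roots cs := by
  obtain ⟨w, s, rfl⟩ := hv
  exact ⟨x * w, s, by rw [rep_mul_apply]⟩

theorem neg_mem_roots {v : V} (hv : v ∈ G.roots cs) : -v ∈ G.roots cs := by
  obtain ⟨w, s, rfl⟩ := hv
  exact ⟨w * cs.simple s, s, by rw [rep_mul_simple_self]⟩

theorem simpleRoot_mem_posRoots (s : S) : G.simpleRoot s ∈ G.posRoots cs :=
  ⟨G.simpleRoot_mem_cone s, 1, s, by rw [rep_one_apply]⟩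

/-! ### Roots of rank-two subsystems -/

open Polynomial.Chebyshev in
-- Each further reflection replaces one coefficient by the Chebyshev recurrence at c = −B(α_s, α_t).
theorem rep_alternatingWord_simpleRoot (s t : S) (k : ℕ) :
    G.rep cs (cs.wordProd (CoxeterSystem.alternatingWord s t k)) (G.simpleRoot s) =
      (U ℝ (k : ℤ)).eval (-G.form (G.simpleRoot s) (G.simpleRoot t)) •
          G.simpleRoot (if Even k then s else t) +
        (U ℝ ((k : ℤ) - 1)).eval (-G.form (G.simpleRoot s) (G.simpleRoot t)) •
          G.simpleRoot (if Even k then t else s) := by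
  induction k with
  | zero => simp [CoxeterSystem.alternatingWord]
  | succ k ih =>
    rw [CoxeterSystem.alternatingWord_succ', cs.wordProd_cons, rep_mul_apply, ih]
    have hU := congrArg (Polynomial.eval (-G.form (G.simpleRoot s) (G.simpleRoot t)))
      (U_add_one ℝ (k : ℤ))
    simp only [Polynomial.eval_sub, Polynomial.eval_mul, Polynomial.eval_ofNat,
      Polynomial.eval_X] at hU
    push_cast
    rw [hU, add_sub_cancel_right, rep_simple]
    by_cases hk : Even k
    · have hk' : ¬ Even (k + 1) := by simpa [Nat.even_add_one] using hk
      simp only [if_pos hk, if_neg hk', map_add, map_smul, form_self, smul_eq_mul,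
        G.form_symm (G.simpleRoot t) (G.simpleRoot s)]
      module
    · have hk' : Even (k + 1) := by simpa [Nat.even_add_one] using hk
      simp only [if_neg hk, if_pos hk', map_add, map_smul, form_self, smul_eq_mul]
      module

open Polynomial.Chebyshev in
-- For c = cos(π/m) the value is sin((k+1)π/m)/sin(π/m), with (k+1)π/m ≤ π; for m = ∞ one has c ≥ 1.
theorem eval_U_nonneg {s t : S} (hst : s ≠ t) {k : ℕ} (hk : M s t ≠ 0 → k + 1 ≤ M s t) :
    0 ≤ (U ℝ (k : ℤ)).eval (-G.form (G.simpleRoot s) (G.simpleRoot t)) := by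
  by_cases h0 : M s t = 0
  · have := one_le_eval_U_of_one_le
      (by linarith [G.form_of_infinite s t h0] :
        1 ≤ -G.form (G.simpleRoot s) (G.simpleRoot t)) k
    linarith
  · have hm : 2 ≤ M s t := by
      have := M.off_diagonal s t hst
      omega
    have hm' : (2 : ℝ) ≤ M s t := by exact_mod_cast hm
    have hkm : (k : ℝ) + 1 ≤ M s t := by exact_mod_cast hk h0
    rw [G.form_of_finite s t h0, neg_neg]
    have hsin : 0 < Real.sin (Real.pi / M s t) := by
      apply Real.sin_pos_of_pos_of_lt_pi (by positivity)
      rw [div_lt_iff₀ (by positivity)]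
      nlinarith [Real.pi_pos]
    refine nonneg_of_mul_nonneg_left ?_ hsin
    rw [U_real_cos]
    apply Real.sin_nonneg_of_nonneg_of_le_pi
    · push_cast
      positivity
    · push_cast
      rw [mul_div_assoc', div_le_iff₀ (by positivity)]
      nlinarith [Real.pi_pos]

/-! ### Descents and signs of roots -/

/-- If `ℓ(ws) > ℓ(w)`, then `w(α_s)` is a positive root. -/
theorem rep_simpleRoot_mem_cone {w : W} {s : S} (h : ¬ cs.IsRightDescent w s) :
    G.rep cs w (G.simpleRoot s) ∈ G.cone := by
  induction hn : cs.length w using Nat.strong_induction_on generalizing w s with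
  | _ n ih =>
  by_cases hw : w = 1
  · rw [hw, rep_one_apply]
    exact G.simpleRoot_mem_cone s
  obtain ⟨t, ht⟩ := cs.exists_rightDescent_of_ne_one hw
  have hst : s ≠ t := by
    rintro rfl
    exact h ht
  have hlen := cs.not_isRightDescent_iff.mp h
  have hlt := cs.isRightDescent_iff.mp ht
  -- Start from ws = (wt)·ts and make the left factor minimal. Since k ≥ 1, `v` is shorter than `w`,
  -- so induction makes both v(α_s) and v(α_t) positive.
  obtain ⟨k, v, hk, hu, hl, hvs, hvt⟩ :=
    cs.exists_eq_mul_alternatingWord (u := w * cs.simple s) (s := s) (t := t) (k := 1)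
      (v := w * cs.simple t)
      (by simp [CoxeterSystem.alternatingWord, cs.wordProd_cons, ← mul_assoc])
      (by omega)
  have hvn : cs.length v < n := by omega
  have hw' : w = v * cs.wordProd (CoxeterSystem.alternatingWord s t k) := by
    rw [CoxeterSystem.alternatingWord_succ, cs.wordProd_concat, ← mul_assoc] at hu
    exact mul_right_cancel hu
  -- Additivity of lengths forces the alternating word of length k + 1 to be reduced.
  have hkm : M s t ≠ 0 → k + 1 ≤ M s t := by
    intro h0
    by_contra hlt'
    rw [M.symmetric] at h0 hlt'
    refine cs.not_isReduced_alternatingWord t s h0 (m := k + 1) (by omega) ?_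
    unfold CoxeterSystem.IsReduced
    have h1 := cs.length_mul_le v (cs.wordProd (CoxeterSystem.alternatingWord t s (k + 1)))
    have h2 := cs.length_wordProd_le (CoxeterSystem.alternatingWord t s (k + 1))
    rw [← hu] at h1
    rw [CoxeterSystem.length_alternatingWord] at h2 ⊢
    omega
  have hcs := ih _ hvn hvs rfl
  have hct := ih _ hvn hvt rfl
  rw [hw', rep_mul_apply, rep_alternatingWord_simpleRoot, map_add, map_smul, map_smul]
  apply G.add_mem_cone
  · apply G.smul_mem_cone (G.eval_U_nonneg hst hkm)
    split_ifs <;> assumption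
  · obtain ⟨j, rfl⟩ : ∃ j, k = j + 1 := ⟨k - 1, by omega⟩
    apply G.smul_mem_cone
    · push_cast
      rw [add_sub_cancel_right]
      exact G.eval_U_nonneg hst fun h0 => (Nat.le_succ _).trans (hkm h0)
    · split_ifs <;> assumption

theorem neg_rep_simpleRoot_mem_cone {w : W} {s : S} (h : cs.IsRightDescent w s) :
    -G.rep cs w (G.simpleRoot s) ∈ G.cone := by
  rw [← rep_mul_simple_self]
  exact G.rep_simpleRoot_mem_cone cs (cs.isRightDescent_iff_not_isRightDescent_mul.mp h)

theorem isRightDescent_of_neg_mem_cone {w : W} {s : S}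
    (h : -G.rep cs w (G.simpleRoot s) ∈ G.cone) : cs.IsRightDescent w s := by
  by_contra hd
  exact G.ne_zero_of_mem_roots cs ⟨w, s, rfl⟩
    (G.eq_zero_of_mem_cone_of_neg_mem_cone (G.rep_simpleRoot_mem_cone cs hd) h)

theorem mem_cone_or_neg_mem_cone {v : V} (hv : v ∈ G.roots cs) : v ∈ G.cone ∨ -v ∈ G.cone := by
  obtain ⟨w, s, rfl⟩ := hv
  by_cases h : cs.IsRightDescent w s
  · exact Or.inr (G.neg_rep_simpleRoot_mem_cone cs h)
  · exact Or.inl (G.rep_simpleRoot_mem_cone cs h)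

theorem rep_injective : Function.Injective (G.rep cs) := by
  rw [injective_iff_map_eq_one]
  intro w hw
  by_contra h1
  obtain ⟨s, hs⟩ := cs.exists_rightDescent_of_ne_one h1
  have h := G.neg_rep_simpleRoot_mem_cone cs hs
  rw [hw] at h
  exact G.ne_zero_of_mem_roots cs (G.simpleRoot_mem_posRoots cs s).2
    (G.eq_zero_of_mem_cone_of_neg_mem_cone (G.simpleRoot_mem_cone s) h)

/-! ### Inversions and additivity of length -/

/-- The only positive root made negative by a simple reflection is its simple root. -/
theorem eq_simpleRoot_of_neg_rep_simple_mem_cone {v : V} {s : S} (hv : v ∈ G.posRoots cs)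
    (h : -G.rep cs (cs.simple s) v ∈ G.cone) : v = G.simpleRoot s := by
  classical
  obtain ⟨⟨c, hc, hcv⟩, hroot⟩ := hv
  obtain ⟨d, hd, hdv⟩ := h
  rw [rep_simple] at hdv
  set b := 2 * G.form (G.simpleRoot s) v with hb
  -- Coefficients over Δ need not be unique, so they cannot be compared directly. Instead `e` is a
  -- linear relation whose only possibly negative coefficient is at `s`; pairing with α_s rules that
  -- out, and positive independence gives e = 0.
  set e : S →₀ ℝ := c + d - Finsupp.single s b with he
  have he0 : Finsupp.linearCombination ℝ G.simpleRoot e = 0 := by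
    rw [he, map_sub, map_add, ← hcv, ← hdv, Finsupp.linearCombination_single]
    module
  have hej : ∀ j, j ≠ s → e j = c j + d j := by
    intro j hj
    simp [he, hj.symm]
  have hes : 0 ≤ e s := by
    by_contra! hneg
    have h1 := congrArg (G.form (G.simpleRoot s)) he0
    rw [Finsupp.linearCombination_apply, Finsupp.sum, map_sum, map_zero] at h1
    refine (Finset.sum_neg' (s := e.support) (fun j _ => ?_)
      ⟨s, Finsupp.mem_support_iff.mpr hneg.ne, ?_⟩).ne h1
    · rw [map_smul, smul_eq_mul]
      rcases eq_or_ne j s with rfl | hj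
      · rw [form_self]
        linarith
      · refine mul_nonpos_of_nonneg_of_nonpos ?_ (G.form_simpleRoot_nonpos hj.symm)
        rw [hej j hj]
        exact add_nonneg (hc j) (hd j)
    · rw [map_smul, form_self, smul_eq_mul, mul_one]
      exact hneg
  have hzero := G.pos_linearIndependent e (fun j => by
    rcases eq_or_ne j s with rfl | hj
    · exact hes
    · rw [hej j hj]
      exact add_nonneg (hc j) (hd j)) he0
  have hcs : c = Finsupp.single s (c s) := by
    ext j
    rcases eq_or_ne j s with rfl | hj
    · simp
    · have h1 := hej j hj
      rw [hzero, Finsupp.zero_apply] at h1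
      rw [Finsupp.single_apply, if_neg hj.symm]
      linarith [hc j, hd j]
  have hv' : v = c s • G.simpleRoot s := by
    rw [hcv]
    conv_lhs => rw [hcs]
    rw [Finsupp.linearCombination_single]
  have h1 := G.form_self_of_mem_roots cs hroot
  rw [hv'] at h1
  simp only [map_smul, LinearMap.smul_apply, form_self, smul_eq_mul, mul_one] at h1
  have : c s = 1 := by nlinarith [hc s]
  rw [hv', this, one_smul]

/-- The reflection `s` keeps the positive root −x⁻¹(β) positive unless it is α_s; then x(α_s) = −β
would be negative although `s` is not a descent of `x`. -/
theorem neg_rep_inv_mul_simple_mem_cone {x : W} {s : S} {β : V} (hβ : β ∈ G.posRoots cs)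
    (hx : -G.rep cs x⁻¹ β ∈ G.cone) (hs : ¬ cs.IsRightDescent x s) :
    -G.rep cs (x * cs.simple s)⁻¹ β ∈ G.cone := by
  have hroot := G.rep_mem_roots cs x⁻¹ hβ.2
  rw [mul_inv_rev, cs.inv_simple, rep_mul_apply, ← map_neg]
  refine (G.mem_cone_or_neg_mem_cone cs
    (G.rep_mem_roots cs _ (G.neg_mem_roots cs hroot))).resolve_right fun h => ?_
  have hδ := G.eq_simpleRoot_of_neg_rep_simple_mem_cone cs ⟨hx, G.neg_mem_roots cs hroot⟩ h
  apply G.ne_zero_of_mem_roots cs hβ.2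
  apply G.eq_zero_of_mem_cone_of_neg_mem_cone hβ.1
  have : -β = G.rep cs x (G.simpleRoot s) := by rw [← hδ, map_neg, rep_rep_inv]
  rw [this]
  exact G.rep_simpleRoot_mem_cone cs hs

/-- Inversions of a prefix are inversions. -/
theorem neg_rep_inv_mul_mem_cone {x y : W} {β : V} (hβ : β ∈ G.posRoots cs)
    (hx : -G.rep cs x⁻¹ β ∈ G.cone) (hxy : cs.length (x * y) = cs.length x + cs.length y) :
    -G.rep cs (x * y)⁻¹ β ∈ G.cone := by
  induction hn : cs.length y generalizing y with
  | zero =>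
    rwa [cs.length_eq_zero_iff.mp hn, mul_one]
  | succ n ih =>
    have hy : y ≠ 1 := fun h => by simp [h] at hn
    obtain ⟨s, hs⟩ := cs.exists_rightDescent_of_ne_one hy
    have hl := cs.isRightDescent_iff.mp hs
    have h1 := cs.length_mul_le x (y * cs.simple s)
    have h2 := cs.length_mul_le (x * (y * cs.simple s)) (cs.simple s)
    have h3 : x * (y * cs.simple s) * cs.simple s = x * y := by simp [mul_assoc]
    rw [h3, cs.length_simple] at h2
    have := G.neg_rep_inv_mul_simple_mem_cone cs (s := s) hβ
      (ih (y := y * cs.simple s) (by omega) (by omega))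
      (by unfold CoxeterSystem.IsRightDescent; rw [h3]; omega)
    rwa [h3] at this

/-- Lengths add if every inversion of `x` is an inversion of `x * y`. -/
theorem length_mul_of_neg_rep_inv_mem_cone {x y : W}
    (h : ∀ β ∈ G.posRoots cs, -G.rep cs x⁻¹ β ∈ G.cone → -G.rep cs (x * y)⁻¹ β ∈ G.cone) :
    cs.length (x * y) = cs.length x + cs.length y := by
  induction hn : cs.length x generalizing x with
  | zero => rw [cs.length_eq_zero_iff.mp hn, one_mul, zero_add]
  | succ n ih =>
    have hx : x ≠ 1 := fun h => by simp [h] at hn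
    obtain ⟨s, hs⟩ := cs.exists_leftDescent_of_ne_one hx
    have hl := cs.isLeftDescent_iff.mp hs
    have hxy : cs.IsLeftDescent (x * y) s := by
      rw [← cs.isRightDescent_inv_iff]
      apply G.isRightDescent_of_neg_mem_cone cs
      exact h _ (G.simpleRoot_mem_posRoots cs s)
        (G.neg_rep_simpleRoot_mem_cone cs (cs.isRightDescent_inv_iff.mpr hs))
    have hl' := cs.isLeftDescent_iff.mp hxy
    -- An inversion β of sx gives the inversion s(β) of `x`: s(β) is positive unless β = α_s, which
    -- would make `s` a left descent of sx.
    have key := ih (x := cs.simple s * x) (fun β hβ hneg => by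
      rw [mul_inv_rev, cs.inv_simple, rep_mul_apply] at hneg
      rw [mul_assoc, mul_inv_rev, cs.inv_simple, rep_mul_apply]
      refine h _ ⟨?_, G.rep_mem_roots cs _ hβ.2⟩ hneg
      refine (G.mem_cone_or_neg_mem_cone cs (G.rep_mem_roots cs _ hβ.2)).resolve_right
        fun hc => ?_
      rw [G.eq_simpleRoot_of_neg_rep_simple_mem_cone cs hβ hc, ← rep_mul_apply] at hneg
      have hd := G.isRightDescent_of_neg_mem_cone cs hneg
      unfold CoxeterSystem.IsRightDescent at hd
      rw [cs.simple_mul_simple_cancel_right, cs.length_inv,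
        ← cs.length_inv (x⁻¹ * cs.simple s), mul_inv_rev, inv_inv, cs.inv_simple] at hd
      omega) (by omega)
    rw [mul_assoc] at key
    omega

theorem mem_inversionSet_iff {w : W} {v : V} :
    v ∈ G.inversionSet cs w ↔ v ∈ G.posRoots cs ∧ -G.rep cs w⁻¹ v ∈ G.cone :=
  ⟨fun h => ⟨h.1, h.2.1⟩,
    fun h => ⟨h.1, h.2, G.neg_mem_roots cs (G.rep_mem_roots cs _ h.1.2)⟩⟩

theorem neg_rep_simpleRoot_mem_inversionSet {w : W} {s : S} (h : cs.IsRightDescent w s) :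
    -(G.rep cs w (G.simpleRoot s)) ∈ G.inversionSet cs w := by
  rw [mem_inversionSet_iff, map_neg, rep_inv_rep, neg_neg]
  exact ⟨⟨G.neg_rep_simpleRoot_mem_cone cs h, G.neg_mem_roots cs ⟨w, s, rfl⟩⟩,
    G.simpleRoot_mem_cone s⟩

theorem rep_conj_simple_apply (x : W) (s : S) (u : V) :
    G.rep cs (x * cs.simple s * x⁻¹) u =
      u - (2 * G.form (G.rep cs x (G.simpleRoot s)) u) • G.rep cs x (G.simpleRoot s) := by
  rw [rep_mul_apply, rep_mul_apply, rep_simple, map_sub, map_smul, rep_rep_inv,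
    ← G.form_rep_rep cs x, rep_rep_inv]

end GeometricRepresentation

/-! ### Prefixes and positivity -/

theorem mainTheorem8 {S W V : Type*} [Group W] [AddCommGroup V] [Module ℝ V]
    {M : CoxeterMatrix S} (cs : CoxeterSystem M W) (G : GeometricRepresentation M V)
    (w : W) (r : S) (hr : cs.IsRightDescent w r) :
    -(G.rep cs w (G.simpleRoot r)) ∈ G.inversionSet cs w ∧
    ∀ (t : W) (αt : V), cs.IsReflection t → G.IsRootOf cs t αt →
      αt = -(G.rep cs w (G.simpleRoot r)) →
      (cs.IsReflectionPrefix t w ↔ ∀ α ∈ G.inversionSet cs w, 0 < G.form α αt) := by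
  refine ⟨G.neg_rep_simpleRoot_mem_inversionSet cs hr, ?_⟩
  intro t αt ht hroot hαt
  have hlen := cs.isRightDescent_iff.mp hr
  have hαmem : αt ∈ G.inversionSet cs w := hαt ▸ G.neg_rep_simpleRoot_mem_inversionSet cs hr
  rw [← G.rep_mul_simple_self cs] at hαt
  set v := w * cs.simple r with hv
  have hw : w = v * cs.simple r := by rw [hv, cs.simple_mul_simple_cancel_right]
  have htv : t = v * cs.simple r * v⁻¹ := by
    apply G.rep_injective cs
    ext u
    rw [G.rep_conj_simple_apply, hroot.2 u, hαt]
  have htw : t = w * v⁻¹ := by rw [htv, ← hw]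
  have htinv : t⁻¹ = t := ht.inv
  have hadd_iff : cs.length t = cs.length w + cs.length v ↔
      ∀ α ∈ G.inversionSet cs w, 0 < G.form α αt := by
    constructor
    · intro hl α hα
      rw [G.mem_inversionSet_iff] at hα
      have hneg := G.neg_rep_inv_mul_mem_cone cs hα.1 hα.2 (y := v⁻¹)
        (by rw [← htw, hl, cs.length_inv])
      rw [← htw, htinv, hroot.2] at hneg
      by_contra! hB
      rw [G.form_symm] at hB
      apply G.ne_zero_of_mem_roots cs (G.rep_mem_roots cs t hα.1.2)
      rw [hroot.2]
      refine G.eq_zero_of_mem_cone_of_neg_mem_cone ?_ hneg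
      rw [sub_eq_add_neg, ← neg_smul]
      exact G.add_mem_cone hα.1.1 (G.smul_mem_cone (by linarith) hroot.1.1)
    · intro hB
      rw [htw, ← cs.length_inv v]
      refine G.length_mul_of_neg_rep_inv_mem_cone cs fun β hβ hneg => ?_
      rw [← htw, htinv]
      refine (G.mem_cone_or_neg_mem_cone cs (G.rep_mem_roots cs t hβ.2)).resolve_left
        fun hpos => ?_
      have hwt : w⁻¹ * t = cs.simple r * w⁻¹ := by
        rw [htv, hw]
        simp [mul_assoc]
      have hwβ := G.rep_mem_roots cs w⁻¹ hβ.2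
      -- Either t(β) is again an inversion of `w`, with pairing opposite to that of β, or −w⁻¹(β) =
      -- α_r, so β = α_t and t(β) = −α_t is negative.
      rcases G.mem_cone_or_neg_mem_cone cs
        (G.rep_mem_roots cs (cs.simple r) (G.neg_mem_roots cs hwβ)) with h | h
      · have hmem : G.rep cs t β ∈ G.inversionSet cs w := by
          rw [G.mem_inversionSet_iff]
          refine ⟨⟨hpos, G.rep_mem_roots cs t hβ.2⟩, ?_⟩
          rwa [← G.rep_mul_apply, hwt, G.rep_mul_apply, ← map_neg]
        have h1 := hB _ hmem
        have h2 := hB β ((G.mem_inversionSet_iff cs).mpr ⟨hβ, hneg⟩)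
        rw [hroot.2, map_sub, map_smul, LinearMap.sub_apply, LinearMap.smul_apply, smul_eq_mul,
          G.form_self_of_mem_roots cs hroot.1.2, G.form_symm αt β] at h1
        linarith
      · have h1 := G.eq_simpleRoot_of_neg_rep_simple_mem_cone cs
          ⟨hneg, G.neg_mem_roots cs hwβ⟩ h
        have hβαt : β = αt := by
          rw [hαt, hv, G.rep_mul_simple_self, ← h1, map_neg, neg_neg, G.rep_rep_inv]
        apply G.ne_zero_of_mem_roots cs hβ.2
        refine G.eq_zero_of_mem_cone_of_neg_mem_cone hβ.1 ?_
        rw [hroot.2, hβαt, G.form_self_of_mem_roots cs hroot.1.2] at hpos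
        rw [hβαt]
        convert hpos using 1
        module
  rw [← hadd_iff]
  constructor
  · rintro ⟨-, -, hp⟩
    obtain ⟨ω, hω, hvω⟩ := cs.exists_isReduced v
    have hwω : cs.wordProd (ω ++ [r]) = w := by
      rw [cs.wordProd_append, cs.wordProd_singleton, ← hvω, ← hw]
    have hωl := hω.eq
    rw [← hvω] at hωl
    have hred : cs.IsReduced (ω ++ [r]) := by
      unfold CoxeterSystem.IsReduced
      rw [hwω, List.length_append, List.length_singleton, ← hωl, hlen]
    obtain ⟨h1, h2⟩ := hp ω r hred hwω
    have h3 := h1.eq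
    rw [h2] at h3
    simp only [List.length_append, List.length_singleton, List.length_reverse] at h3
    omega
  · intro hl
    refine ⟨ht, ?_, fun ω s hred hprod => ?_⟩
    · rintro rfl
      exact cs.not_isRightDescent_one r hr
    have hwl := hred.eq
    rw [hprod, List.length_append, List.length_singleton] at hwl
    rw [cs.wordProd_append, cs.wordProd_singleton] at hprod
    have hωs : cs.wordProd ω = w * cs.simple s := by
      rw [← hprod, cs.simple_mul_simple_cancel_right]
    have hsd : cs.IsRightDescent w s := by
      unfold CoxeterSystem.IsRightDescent
      rw [← hωs]
      have := cs.length_wordProd_le ω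
      omega
    -- A second descent `s` would give the inversion −w(α_s), whose pairing with α_t is B(α_s, α_r)
    -- ≤ 0.
    have hsr : s = r := by
      by_contra hne
      have h1 := hadd_iff.mp hl _ (G.neg_rep_simpleRoot_mem_inversionSet cs hsd)
      rw [hαt, hv, G.rep_mul_simple_self, map_neg, map_neg, LinearMap.neg_apply, neg_neg,
        G.form_rep_rep] at h1
      exact absurd (G.form_simpleRoot_nonpos hne) (not_le.mpr h1)
    subst hsr
    have hprodt : cs.wordProd (ω ++ [s] ++ ω.reverse) = t := by
      rw [cs.wordProd_append, cs.wordProd_append, cs.wordProd_singleton, cs.wordProd_reverse,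
        hωs, htv]
    refine ⟨?_, hprodt⟩
    unfold CoxeterSystem.IsReduced
    rw [hprodt, hl]
    simp only [List.length_append, List.length_singleton, List.length_reverse]
    omega
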